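/- Let $K,M,N,Z_y$ be positive integers with $Z_y\le N$ and $(K,N)\neq(1,1)$. Write $\tau_{s,t,N}=\min\{|t-s|,\,2N-1-|t-s|\}$ for $0\le s,t\le 2N-2$. A weight vector is $\mathbf w=(w_0,\dots,w_{2N-2})$ with $w_r\ge 0$ and $\sum_r w_r=1$. Let $\mathbf Q_{2N-1}$ be the $(2N-1)\times(2N-1)$ matrix with diagonal entries $a$ and off-diagonal entries $\tau_{s,t,N}$, so that $$\mathbf Q_{2N-1}(\mathbf w,a)=\mathbf w\,\mathbf Q_{2N-1}\,\mathbf w^T=a\sum_{i=0}^{2N-2}w_i^2+\sum_{s,t=0}^{2N-2}\tau_{s,t,N}w_sw_t .$$ Consider a set of $K$ Doppler-resilient complementary sequences, each consisting of $M$ unimodular sequences of length $N$, whose aperiodic ambiguity functions have maximum magnitude $\theta_{\max}$ over the delay-Doppler zone $(-N,N)\times(-Z_y,Z_y)$. For every weight vector $\mathbf w$ with $1-\frac1K\sum_r w_r^2\ne 0$ (automatic if $K\ge 2$) one considers the lower bound $\theta_{\max}^2\ge B(\mathbf w)$, where $$B(\mathbf w)=M\left(N-\frac{\mathbf Q_{2N-1}\!\left(\mathbf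 w,\frac{N(MN-Z_y)}{KZ_y}\right)}{1-\frac1K\sum_{r=0}^{2N-2}w_r^2}\right).$$ The uniform choice $w_r=\frac1{2N-1}$ is admissible and yields the bound $\theta_{\max}^2\ge B_0$, with $$B_0=M^2N^2\,\frac{KZ_y/M-1}{[K(2N-1)-1]Z_y}.$$ (1) If $$K\le\left\lfloor\frac{4(MN-Z_y)N}{Z_y}\sin^2\frac{\pi}{2(2N-1)}\right\rfloor ,$$ then the bound $B_0$ cannot be improved by another choice of the weight vector: $B_0$ is the value of $B$ at the uniform weight vector, and $B(\mathbf w)\le B_0$ for every weight vector $\mathbf w$ with $1-\frac1K\sum_r w_r^2\neq0$. (2) For fixed $M,Z_y\ge 1$, as $N\to\infty$ the condition in (1) becomes $K\le\left\lfloor\frac{\pi^2M}{4Z_y}\right\rfloor$. That is, $$\lim_{N\to\infty}\frac{4(MN-Z_y)N}{Z_y}\sin^2\frac{\pi}{2(2N-1)}=\frac{\pi^2M}{4Z_y},$$ for all sufficiently large $N$ the integer parts of the two sides, $\left\lfloor\frac{4(MN-Z_y)N}{Z_y}\sin^2\frac{\pi}{2(2N-1)}\right\rfloor$ and $\left\lfloor\frac{\pi^2M}{4Z_y}\right\rfloor$,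 are equal, and hence for all sufficiently large $N$ the conclusion of (1) holds for every positive integer $K\le\left\lfloor\frac{\pi^2M}{4Z_y}\right\rfloor$. -/

import Mathlib

open Filter Topology

noncomputable section

/-- Weight vectors `w = (w_0, …, w_{2N-2})`: nonnegative entries with sum one. -/
def weightVectors (N : ℕ) : Set (Fin (2 * N - 1) → ℝ) :=
  {w | (∀ r, 0 ≤ w r) ∧ ∑ r, w r = 1}

/-- The uniform weight vector `w_r = 1 / (2N-1)`. -/
def uniformWeight (N : ℕ) : Fin (2 * N - 1) → ℝ :=
  fun _ => 1 / (2 * (N : ℝ) - 1)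

/-- `τ_{s,t,N} = min {|t - s|, 2N - 1 - |t - s|}`. -/
def cyclicDist (N : ℕ) (s t : Fin (2 * N - 1)) : ℝ :=
  min |((t : ℕ) : ℝ) - ((s : ℕ) : ℝ)| (2 * (N : ℝ) - 1 - |((t : ℕ) : ℝ) - ((s : ℕ) : ℝ)|)

/-- The matrix `Q_{2N-1}`: diagonal entries `a`, off-diagonal entries `τ_{s,t,N}`. -/
def quadMatrix (N : ℕ) (a : ℝ) : Matrix (Fin (2 * N - 1)) (Fin (2 * N - 1)) ℝ :=
  Matrix.of fun s t => if s = t then a else cyclicDist N s t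

/-- The quadratic form `Q_{2N-1}(w, a) = w Q_{2N-1} wᵀ`. -/
def quadForm (N : ℕ) (w : Fin (2 * N - 1) → ℝ) (a : ℝ) : ℝ :=
  dotProduct w (Matrix.mulVec (quadMatrix N a) w)

/-- The denominator `1 - (1/K) ∑ w_r²` of the weighted lower bound. -/
def boundDenom (K N : ℕ) (w : Fin (2 * N - 1) → ℝ) : ℝ :=
  1 - 1 / (K : ℝ) * ∑ r, w r ^ 2

/-- The lower bound for `θ_max²` given by the weight vector `w`. It is meaningful when
`boundDenom K N w ≠ 0`. -/
def weightedBound (K M N Zy : ℕ) (w : Fin (2 * N - 1) → ℝ) : ℝ :=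
  (M : ℝ) * ((N : ℝ) -
    quadForm N w ((N : ℝ) * ((M : ℝ) * (N : ℝ) - (Zy : ℝ)) / ((K : ℝ) * (Zy : ℝ)))
      / boundDenom K N w)

/-- The closed-form lower bound for `θ_max²`,
`M² N² (K Z_y / M - 1) / ([K (2N-1) - 1] Z_y)`. -/
def uniformBound (K M N Zy : ℕ) : ℝ :=
  (M : ℝ) ^ 2 * (N : ℝ) ^ 2 *
    (((K : ℝ) * (Zy : ℝ) / (M : ℝ) - 1) /
      (((K : ℝ) * (2 * (N : ℝ) - 1) - 1) * (Zy : ℝ)))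

/-- The closed-form bound cannot be improved by the choice of the weight vector: it is the value
of the weighted bound at the uniform weight vector (an admissible choice), and it is the greatest
value of the weighted bound over all weight vectors for which that bound is defined. -/
def CannotBeImproved (K M N Zy : ℕ) : Prop :=
  uniformWeight N ∈ weightVectors N ∧
  boundDenom K N (uniformWeight N) ≠ 0 ∧
  weightedBound K M N Zy (uniformWeight N) = uniformBound K M N Zy ∧
  IsGreatest {b : ℝ | ∃ w ∈ weightVectors N, boundDenom K N w ≠ 0 ∧ b = weightedBound K M N Zy w}
    (uniformBound K M N Zy)

/-- `4 (MN - Z_y) N / Z_y * sin² (π / (2 (2N-1)))`. -/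
def setSizeThreshold (M N Zy : ℕ) : ℝ :=
  4 * ((M : ℝ) * (N : ℝ) - (Zy : ℝ)) * (N : ℝ) / (Zy : ℝ) *
    Real.sin (Real.pi / (2 * (2 * (N : ℝ) - 1))) ^ 2

end

/-!
The denominator `1 - (1/K) ∑ w_r²` is largest at the uniform weight vector, because `∑ w_r²` is
smallest there. So the uniform weight vector is optimal as soon as it also minimizes the quadratic
form `a ∑ w_r² + ∑ τ_{s,t} w_s w_t`. Put `N = L + 1`, so that the indices form the cycle
`ℤ / (2L+1)` and `τ` is the cyclic distance. The number of arcs of length `L` containing both `s`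
and `t` is `L - τ_{s,t}`, hence `∑ τ_{s,t} w_s w_t = L (∑ w_s)² - ∑ S_i²`, where `S_i` is the sum of
`w` over the arc starting at `i` (`sum_arcSum_sq`).

Let `v` be `w` minus the uniform weight vector. For the arc sums of `v`, two consecutive arcs leave
out one point, so `S_i + S_{i+L} = -v_{i-1}`. Walking around the cycle in steps of `L`, the claim
becomes the inequality `∑ (x_j + x_{j+1})² ≥ 4 sin² (π / (2n)) ∑ x_j²` on the odd cycle of length
`n = 2L+1` (`odd_cycle_sum_sq_le`). Multiplying `x_j` by `(-1)ʲ` makes it the Wirtinger inequality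
for antiperiodic sequences, which is reduced to the Dirichlet case by subtracting a cosine and
proved there by comparison with the ground state `sin (π j / n)`. It follows that the uniform
weight vector minimizes the quadratic form when `4 a sin² (π / (2n)) ≥ 1`
(`quadForm_uniformWeight_le`), and for `a = N (MN - Z_y) / (K Z_y)` this is the bound on `K`.

The limit of the threshold is that of `sin x / x`. It need not be approached from above,
so equality of the integer parts needs that the limit `π² M / (4 Z_y)` is not an integer. This is
the irrationality of `π²`, proved with Cartwright's integrals (`irrational_pi_sq`).
-/

/-! ### Wirtinger inequalities for sequences -/

theorem four_mul_sin_pi_div_sq (n : ℝ) :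
    4 * Real.sin (Real.pi / (2 * n)) ^ 2 = 2 - 2 * Real.cos (Real.pi / n) := by
  have h : Real.pi / n = 2 * (Real.pi / (2 * n)) := by field_simp
  rw [h, Real.cos_two_mul, Real.cos_sq']
  ring

/-- The discrete Wirtinger inequality for sequences vanishing at both ends: the constant is the
lowest Dirichlet eigenvalue of the path, with ground state `j ↦ sin (π j / n)`. -/
theorem wirtinger_dirichlet {n : ℕ} (hn : 1 ≤ n) (g : ℕ → ℝ) (h0 : g 0 = 0) (hgn : g n = 0) :
    4 * Real.sin (Real.pi / (2 * n)) ^ 2 * ∑ j ∈ Finset.range n, g j ^ 2 ≤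
      ∑ j ∈ Finset.range n, (g (j + 1) - g j) ^ 2 := by
  have hn' : (0 : ℝ) < n := by exact_mod_cast hn
  set θ : ℝ := Real.pi / n with hθ
  have hnθ : n * θ = Real.pi := by rw [hθ]; field_simp
  have hμ : 4 * Real.sin (Real.pi / (2 * n)) ^ 2 = 2 - 2 * Real.cos θ :=
    four_mul_sin_pi_div_sq n
  have hθ0 : 0 < θ := by positivity
  have hpos : ∀ m : ℕ, 1 ≤ m → m < n → 0 < Real.sin (m * θ) := fun m h1 h2 => by
    have h1' : (0 : ℝ) < m := by exact_mod_cast h1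
    have h2' : (m : ℝ) < n := by exact_mod_cast h2
    exact Real.sin_pos_of_pos_of_lt_pi (by positivity) (by rw [← hnθ]; gcongr)
  have hrec : ∀ m : ℕ, Real.sin ((m + 1 + 1 : ℝ) * θ) =
      2 * Real.cos θ * Real.sin ((m + 1 : ℝ) * θ) - Real.sin (m * θ) := fun m => by
    have e1 : (m + 1 + 1 : ℝ) * θ = (m + 1) * θ + θ := by ring
    have e2 : (m : ℝ) * θ = (m + 1) * θ - θ := by ring
    rw [e1, e2, Real.sin_add, Real.sin_sub]
    ring
  rw [hμ]
  -- the energy up to `m + 1` is bounded below by the logarithmic difference of the ground state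
  -- at `m + 1` (the Riccati form of Picone's identity)
  have key : ∀ m : ℕ, m + 1 < n →
      g (m + 1) ^ 2 * (1 - Real.sin (m * θ) / Real.sin ((m + 1 : ℝ) * θ)) ≤
      ∑ j ∈ Finset.range (m + 1), ((g (j + 1) - g j) ^ 2 - (2 - 2 * Real.cos θ) * g j ^ 2) := by
    intro m
    induction m with
    | zero => intro _; simp [h0]
    | succ m ih =>
      intro hm
      rw [Finset.sum_range_succ]
      have h := ih (by lia)
      have p1 := hpos (m + 1) (by lia) (by lia)
      have p2 := hpos (m + 1 + 1) (by lia) hm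
      have hr := hrec m
      push_cast at p1 p2 ⊢
      set s := Real.sin ((m + 1 : ℝ) * θ)
      set r := Real.sin ((m + 1 + 1 : ℝ) * θ)
      -- completing the square with the consecutive values `s`, `r` of the ground state
      have hsq : 0 ≤ (r * g (m + 1) - s * g (m + 1 + 1)) ^ 2 / (s * r) := by positivity
      have hid : (r * g (m + 1) - s * g (m + 1 + 1)) ^ 2 / (s * r) =
          g (m + 1) ^ 2 * (1 - Real.sin (m * θ) / s) +
          ((g (m + 1 + 1) - g (m + 1)) ^ 2 - (2 - 2 * Real.cos θ) * g (m + 1) ^ 2) -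
          g (m + 1 + 1) ^ 2 * (1 - s / r) := by
        have hm' : Real.sin (m * θ) = 2 * Real.cos θ * s - r := by linarith
        rw [hm']
        field_simp
        ring
      linarith
  suffices 0 ≤ ∑ j ∈ Finset.range n,
      ((g (j + 1) - g j) ^ 2 - (2 - 2 * Real.cos θ) * g j ^ 2) by
    rw [Finset.sum_sub_distrib, ← Finset.mul_sum] at this
    linarith
  -- in the last step the ground state vanishes, so the bound at `n - 1` is used directly
  obtain rfl | ⟨k, rfl⟩ : n = 1 ∨ ∃ k, n = k + 1 + 1 := by
    rcases n with _ | _ | k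
    · lia
    · simp
    · right; exact ⟨k, rfl⟩
  · simp [h0, hgn]
  · rw [Finset.sum_range_succ, hgn]
    have h := key k (by lia)
    have p1 := hpos (k + 1) (by lia) (by lia)
    have hr := hrec k
    push_cast at p1 hnθ
    rw [hnθ, Real.sin_pi] at hr
    have hk : Real.sin (k * θ) = 2 * Real.cos θ * Real.sin ((k + 1 : ℝ) * θ) := by linarith
    rw [hk, mul_div_assoc, div_self p1.ne'] at h
    linarith

/-- The discrete Wirtinger inequality for antiperiodic sequences. Both `cos (π j / n)` and
`sin (π j / n)` attain equality, so subtracting the multiple of the cosine that cancels `y 0`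
reduces to the Dirichlet case. -/
theorem wirtinger_antiperiodic {n : ℕ} (hn : 1 ≤ n) (y : ℕ → ℝ) (hy : y n = -y 0) :
    4 * Real.sin (Real.pi / (2 * n)) ^ 2 * ∑ j ∈ Finset.range n, y j ^ 2 ≤
      ∑ j ∈ Finset.range n, (y (j + 1) - y j) ^ 2 := by
  have hn' : (0 : ℝ) < n := by exact_mod_cast hn
  set θ : ℝ := Real.pi / n with hθ
  have hnθ : n * θ = Real.pi := by rw [hθ]; field_simp
  have hμ : 4 * Real.sin (Real.pi / (2 * n)) ^ 2 = 2 - 2 * Real.cos θ :=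
    four_mul_sin_pi_div_sq n
  set g : ℕ → ℝ := fun j => y j - y 0 * Real.cos (j * θ) with hg
  have h := wirtinger_dirichlet hn g (by simp [hg]) (by simp [hg, hnθ, hy])
  rw [hμ] at h ⊢
  -- `y` and `g` have the same energy: the difference telescopes to a vanishing boundary term
  set H : ℕ → ℝ := fun j => (2 * y 0 * g j + y 0 ^ 2 * Real.cos (j * θ)) *
    (Real.cos (j * θ) - Real.cos ((j - 1 : ℝ) * θ)) with hH
  have htel := Finset.sum_range_sub H n
  have hHn : H n = H 0 := by
    have e1 : ((n : ℝ) - 1) * θ = Real.pi - θ := by rw [sub_mul, hnθ, one_mul]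
    simp only [hH, hg, e1, hnθ, Real.cos_pi, Real.cos_pi_sub, hy, Nat.cast_zero, zero_mul,
      Real.cos_zero, zero_sub, neg_mul, one_mul, Real.cos_neg]
    ring
  have hstep : ∀ j, H (j + 1) - H j =
      ((y (j + 1) - y j) ^ 2 - (2 - 2 * Real.cos θ) * y j ^ 2) -
      ((g (j + 1) - g j) ^ 2 - (2 - 2 * Real.cos θ) * g j ^ 2) := by
    intro j
    have e1 : ((j : ℝ) + 1) * θ = j * θ + θ := by ring
    have e2 : ((j : ℝ) - 1) * θ = j * θ - θ := by ring
    simp only [hH, hg]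
    push_cast
    rw [show ((j : ℝ) + 1 - 1) = j by ring, e1, e2, Real.cos_add, Real.cos_sub]
    ring
  simp only [hstep, Finset.sum_sub_distrib, ← Finset.mul_sum] at htel
  linarith

/-- On an odd cycle the sign change `x j ↦ (-1)ʲ x j` turns a periodic sequence into an
antiperiodic one and sums of neighbours into differences. -/
theorem odd_cycle_sum_sq_le (L : ℕ) (x : ℕ → ℝ) (hx : x (2 * L + 1) = x 0) :
    4 * Real.sin (Real.pi / (2 * (2 * (L : ℝ) + 1))) ^ 2 * ∑ j ∈ Finset.range (2 * L + 1), x j ^ 2 ≤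
      ∑ j ∈ Finset.range (2 * L + 1), (x j + x (j + 1)) ^ 2 := by
  have h := wirtinger_antiperiodic (n := 2 * L + 1) (by lia) (fun j => (-1) ^ j * x j)
    (by simp [hx, pow_succ, pow_mul])
  have e1 : ∀ j : ℕ, ((-1 : ℝ) ^ j * x j) ^ 2 = x j ^ 2 := fun j => by
    rw [mul_pow, ← pow_mul, mul_comm j, pow_mul]; simp
  have e2 : ∀ j : ℕ, ((-1 : ℝ) ^ (j + 1) * x (j + 1) - (-1) ^ j * x j) ^ 2 =
      (x j + x (j + 1)) ^ 2 := fun j => by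
    have : (-1 : ℝ) ^ (j + 1) * x (j + 1) - (-1) ^ j * x j = (-1) ^ j * -(x j + x (j + 1)) := by
      ring
    rw [this, mul_pow, ← pow_mul, mul_comm j, pow_mul, neg_one_sq, one_pow, one_mul,
      neg_sq]
  simp only [e1, e2] at h
  push_cast at h
  exact h

/-! ### Arc sums and the cyclic distance -/

/-- The sum of `v` over the arc `{i, i + 1, …, i + L - 1}` of the cycle `ℤ / (2L+1)`. -/
def arcSum (L : ℕ) (v : ZMod (2 * L + 1) → ℝ) (i : ZMod (2 * L + 1)) : ℝ :=
  ∑ s, if (s - i).val < L then v s else 0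

theorem ZMod.sum_eq_sum_range_val (L : ℕ) (f : ℕ → ℝ) :
    ∑ k : ZMod (2 * L + 1), f k.val = ∑ k ∈ Finset.range (2 * L + 1), f k :=
  Fin.sum_univ_eq_sum_range f (2 * L + 1)

/-- Multiplication by `L` permutes `ℤ / (2L+1)`, because `-2 * L = 1` there. -/
theorem sum_range_mul_eq_sum_zmod (L : ℕ) (f : ZMod (2 * L + 1) → ℝ) :
    ∑ j ∈ Finset.range (2 * L + 1), f (j * L) = ∑ i, f i := by
  rw [← ZMod.sum_eq_sum_range_val L (fun j => f (j * L))]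
  have hz : (2 * L + 1 : ZMod (2 * L + 1)) = 0 := by
    exact_mod_cast ZMod.natCast_self (2 * L + 1)
  refine Fintype.sum_bijective (fun k : ZMod (2 * L + 1) => k * L) ?_ _ _ ?_
  · refine Function.bijective_iff_has_inverse.2 ⟨fun k => -2 * k, fun k => ?_, fun k => ?_⟩
    · linear_combination -k * hz
    · linear_combination -k * hz
  · intro k
    rw [ZMod.natCast_zmod_val]

/-- Two arcs of length `L` in a cycle of length `2L+1`, shifted by `e` against each other, overlap in
`L - d` points, where `d` is the cyclic distance from `0` to `e`. -/
theorem card_arc_overlap {L e : ℕ} (he : e < 2 * L + 1) :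
    (∑ k ∈ Finset.range (2 * L + 1), if k < L ∧ (k + e) % (2 * L + 1) < L then (1 : ℝ) else 0) =
      L - min (e : ℝ) (2 * L + 1 - e) := by
  rw [Finset.sum_boole]
  have hmod : ∀ k, k < 2 * L + 1 → (k + e) % (2 * L + 1) =
      if k + e < 2 * L + 1 then k + e else k + e - (2 * L + 1) := by
    intro k hk
    split_ifs with h
    · exact Nat.mod_eq_of_lt h
    · rw [Nat.mod_eq_sub_mod (by lia), Nat.mod_eq_of_lt (by lia)]
  rcases le_or_gt e L with h | h
  · have hs : Finset.filter (fun k => k < L ∧ (k + e) % (2 * L + 1) < L)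
        (Finset.range (2 * L + 1)) = Finset.range (L - e) := by
      ext k
      simp only [Finset.mem_filter, Finset.mem_range]
      constructor
      · rintro ⟨h1, h2, h3⟩
        rw [hmod k h1] at h3
        split_ifs at h3 <;> lia
      · intro h1
        refine ⟨by lia, by lia, ?_⟩
        rw [hmod k (by lia)]
        split_ifs <;> lia
    have h' : (e : ℝ) ≤ L := by exact_mod_cast h
    rw [hs, Finset.card_range, Nat.cast_sub h, min_eq_left (by linarith)]
  · have hs : Finset.filter (fun k => k < L ∧ (k + e) % (2 * L + 1) < L)
        (Finset.range (2 * L + 1)) = Finset.Ico (2 * L + 1 - e) L := by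
      ext k
      simp only [Finset.mem_filter, Finset.mem_range, Finset.mem_Ico]
      constructor
      · rintro ⟨h1, h2, h3⟩
        rw [hmod k h1] at h3
        split_ifs at h3 <;> lia
      · rintro ⟨h1, h2⟩
        refine ⟨by lia, by lia, ?_⟩
        rw [hmod k (by lia)]
        split_ifs <;> lia
    have h' : (L : ℝ) + 1 ≤ e := by exact_mod_cast h
    rw [hs, Nat.card_Ico, Nat.cast_sub (by lia), Nat.cast_sub (by lia), min_eq_right (by linarith)]
    push_cast
    ring

theorem min_val_sub (L : ℕ) (s t : ZMod (2 * L + 1)) :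
    min ((t - s).val : ℝ) (2 * L + 1 - (t - s).val) =
      min |(t.val : ℝ) - s.val| (2 * L + 1 - |(t.val : ℝ) - s.val|) := by
  rcases le_total s.val t.val with h | h
  · have h' : (s.val : ℝ) ≤ t.val := by exact_mod_cast h
    rw [ZMod.val_sub h, Nat.cast_sub h, abs_of_nonneg (by linarith)]
  · have h' : (t.val : ℝ) ≤ s.val := by exact_mod_cast h
    rcases eq_or_ne s t with rfl | hne
    · simp
    · have hst : s - t ≠ 0 := sub_ne_zero.2 hne
      have : NeZero (s - t) := ⟨hst⟩
      rw [← neg_sub s t, ZMod.val_neg_of_ne_zero, Nat.cast_sub (ZMod.val_le _), ZMod.val_sub h,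
        Nat.cast_sub h, abs_of_nonpos (by linarith), min_comm]
      push_cast
      congr 1 <;> ring

/-- The number of arcs of length `L` that contain both `s` and `t` is `L` minus their cyclic
distance. -/
theorem sum_arc_indicator_mul (L : ℕ) (s t : ZMod (2 * L + 1)) :
    (∑ i : ZMod (2 * L + 1),
      if (s - i).val < L ∧ (t - i).val < L then (1 : ℝ) else 0) =
      L - min |(t.val : ℝ) - s.val| (2 * L + 1 - |(t.val : ℝ) - s.val|) := by
  rw [← min_val_sub, ← card_arc_overlap (ZMod.val_lt _),
    ← ZMod.sum_eq_sum_range_val L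
      (fun k => if k < L ∧ (k + (t - s).val) % (2 * L + 1) < L then (1 : ℝ) else 0)]
  refine Fintype.sum_equiv (Equiv.subLeft s) _ _ fun i => ?_
  rw [Equiv.subLeft_apply, ← ZMod.val_add, show s - i + (t - s) = t - i by ring]

/-- The quadratic form of the cyclic distance is, up to the square of the total mass, minus the
sum of squared arc sums. -/
theorem sum_arcSum_sq (L : ℕ) (w : ZMod (2 * L + 1) → ℝ) :
    ∑ i, arcSum L w i ^ 2 = L * (∑ s, w s) ^ 2 - ∑ s, ∑ t,
      min |(t.val : ℝ) - s.val| (2 * L + 1 - |(t.val : ℝ) - s.val|) * (w s * w t) := by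
  have h : ∀ i, arcSum L w i ^ 2 = ∑ s, ∑ t,
      (if (s - i).val < L ∧ (t - i).val < L then (1 : ℝ) else 0) * (w s * w t) := fun i => by
    rw [arcSum, sq, Finset.sum_mul_sum]
    refine Finset.sum_congr rfl fun s _ => Finset.sum_congr rfl fun t _ => ?_
    split_ifs <;> simp_all
  simp only [h]
  rw [Finset.sum_comm]
  rw [sq, Finset.sum_mul_sum, Finset.mul_sum, ← Finset.sum_sub_distrib]
  refine Finset.sum_congr rfl fun s _ => ?_
  rw [Finset.sum_comm, Finset.mul_sum, ← Finset.sum_sub_distrib]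
  refine Finset.sum_congr rfl fun t _ => ?_
  rw [← Finset.sum_mul, sum_arc_indicator_mul]
  ring

/-- Two consecutive arcs of length `L` and the one remaining point `i + 2L = i - 1` make up the
whole cycle. -/
theorem arcSum_add_arcSum (L : ℕ) (v : ZMod (2 * L + 1) → ℝ) (i : ZMod (2 * L + 1)) :
    arcSum L v i + arcSum L v (i + L) + v (i - 1) = ∑ s, v s := by
  have hz : (2 * L + 1 : ZMod (2 * L + 1)) = 0 := by
    exact_mod_cast ZMod.natCast_self (2 * L + 1)
  have h1 : v (i - 1) = ∑ s, if s = i - 1 then v s else 0 := by simp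
  rw [arcSum, arcSum, h1, ← Finset.sum_add_distrib, ← Finset.sum_add_distrib]
  refine Finset.sum_congr rfl fun s _ => ?_
  obtain ⟨m, hm, hs⟩ : ∃ m : ℕ, m < 2 * L + 1 ∧ s = i + m :=
    ⟨(s - i).val, ZMod.val_lt _, by rw [ZMod.natCast_zmod_val]; ring⟩
  have e1 : (s - i).val = m := by
    rw [hs, add_sub_cancel_left, ZMod.val_cast_of_lt hm]
  have e2 : (s - (i + L)).val = if m < L then m + L + 1 else m - L := by
    split_ifs with h
    · have : s - (i + L) = ((m + L + 1 : ℕ) : ZMod (2 * L + 1)) := by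
        push_cast; rw [hs]; linear_combination -hz
      rw [this, ZMod.val_cast_of_lt (by lia)]
    · have : s - (i + L) = ((m - L : ℕ) : ZMod (2 * L + 1)) := by
        rw [Nat.cast_sub (by lia), hs]; ring
      rw [this, ZMod.val_cast_of_lt (by lia)]
  have e3 : s = i - 1 ↔ m = 2 * L := by
    have : i - 1 = i + ((2 * L : ℕ) : ZMod (2 * L + 1)) := by
      push_cast; linear_combination -hz
    rw [this, hs, add_right_inj]
    constructor
    · intro h
      have := congrArg ZMod.val h
      rwa [ZMod.val_cast_of_lt hm, ZMod.val_cast_of_lt (by lia)] at this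
    · rintro rfl; rfl
  simp only [e1, e2, e3]
  split_ifs <;> first | (exfalso; lia) | simp

/-- For a vector of total mass zero, in the cyclic order of step `L` the arc sums of neighbours add
up to minus an entry of `v`, so the odd cycle inequality applies to the arc sums. -/
theorem sum_arcSum_sq_le (L : ℕ) (v : ZMod (2 * L + 1) → ℝ) (hv : ∑ s, v s = 0) :
    4 * Real.sin (Real.pi / (2 * (2 * (L : ℝ) + 1))) ^ 2 * ∑ i, arcSum L v i ^ 2 ≤
      ∑ s, v s ^ 2 := by
  have hz : ((2 * L + 1 : ℕ) : ZMod (2 * L + 1)) = 0 := ZMod.natCast_self _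
  have h := odd_cycle_sum_sq_le L (fun j => arcSum L v (j * L)) (by simp only [hz]; simp)
  rw [sum_range_mul_eq_sum_zmod L (fun i => arcSum L v i ^ 2)] at h
  have e : ∀ j : ℕ, arcSum L v (j * L) + arcSum L v (((j + 1 : ℕ) : ZMod (2 * L + 1)) * L) =
      -v (j * L - 1) := fun j => by
    have := arcSum_add_arcSum L v (j * L)
    rw [hv] at this
    rw [show ((j + 1 : ℕ) : ZMod (2 * L + 1)) * L = j * L + L by push_cast; ring]
    linarith
  simp only [e, neg_sq] at h
  rw [sum_range_mul_eq_sum_zmod L (fun i => v (i - 1) ^ 2)] at h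
  rwa [Fintype.sum_equiv (Equiv.subRight 1) (fun i => v (i - 1) ^ 2) (fun i => v i ^ 2)
    (fun _ => rfl)] at h

theorem arcSum_const (L : ℕ) (c : ℝ) (i : ZMod (2 * L + 1)) :
    arcSum L (fun _ => c) i = L * c := by
  have h : arcSum L (fun _ => c) i =
      c * ∑ k : ZMod (2 * L + 1), if k.val < L then (1 : ℝ) else 0 := by
    rw [arcSum, Finset.mul_sum]
    refine Fintype.sum_equiv (Equiv.subRight i) _ _ fun s => ?_
    simp
  have hs : Finset.filter (fun k => k < L) (Finset.range (2 * L + 1)) = Finset.range L := by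
    ext k; simp only [Finset.mem_filter, Finset.mem_range]; lia
  rw [h, ZMod.sum_eq_sum_range_val L (fun k => if k < L then (1 : ℝ) else 0), Finset.sum_boole,
    hs, Finset.card_range, mul_comm]

theorem sum_arcSum (L : ℕ) (v : ZMod (2 * L + 1) → ℝ) :
    ∑ i, arcSum L v i = L * ∑ s, v s := by
  have h : ∀ s, (∑ i : ZMod (2 * L + 1), if (s - i).val < L then v s else 0) = L * v s := fun s => by
    rw [← arcSum_const L (v s) 0, arcSum]
    refine Fintype.sum_equiv (Equiv.subLeft s) _ _ fun i => ?_
    simp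
  simp only [arcSum]
  rw [Finset.sum_comm, Finset.mul_sum]
  exact Finset.sum_congr rfl fun s _ => h s

/-- The quadratic form of the cyclic distance at a constant vector. -/
theorem sum_cyclic_const (L : ℕ) (c : ℝ) :
    (∑ s : ZMod (2 * L + 1), ∑ t : ZMod (2 * L + 1),
      min |(t.val : ℝ) - s.val| (2 * L + 1 - |(t.val : ℝ) - s.val|) * (c * c)) =
      L * (L + 1) * (2 * L + 1) * c ^ 2 := by
  have h := sum_arcSum_sq L (fun _ => c)
  simp only [arcSum_const, Finset.sum_const, Finset.card_univ, ZMod.card, nsmul_eq_mul] at h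
  push_cast at h
  linarith

/-- Among vectors of total mass one, the quadratic form of the cyclic distance falls below its value
at the uniform vector by at most `1 / (4 sin² (π / (2 (2L+1))))` times the squared distance to the
uniform vector. -/
theorem le_sum_cyclic (L : ℕ) (w : ZMod (2 * L + 1) → ℝ) (hw : ∑ s, w s = 1) :
    4 * Real.sin (Real.pi / (2 * (2 * (L : ℝ) + 1))) ^ 2 * (L * (L + 1) / (2 * L + 1) -
      ∑ s, ∑ t, min |(t.val : ℝ) - s.val| (2 * L + 1 - |(t.val : ℝ) - s.val|) * (w s * w t)) ≤
      ∑ s, w s ^ 2 - 1 / (2 * L + 1) := by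
  set u : ℝ := 1 / (2 * L + 1) with hu
  have hnu : (2 * L + 1) * u = 1 := by rw [hu]; field_simp
  have hv : ∑ s, (w s - u) = 0 := by
    rw [Finset.sum_sub_distrib, hw]
    simp only [Finset.sum_const, Finset.card_univ, ZMod.card, nsmul_eq_mul]
    push_cast
    linarith
  have h := sum_arcSum_sq_le L (fun s => w s - u) hv
  have e1 : ∑ s, (w s - u) ^ 2 = ∑ s, w s ^ 2 - u := by
    simp only [sub_sq, Finset.sum_add_distrib, Finset.sum_sub_distrib, ← Finset.sum_mul,
      ← Finset.mul_sum, hw]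
    simp only [Finset.sum_const, Finset.card_univ, ZMod.card, nsmul_eq_mul]
    push_cast
    linear_combination u * hnu
  have e2 : ∀ i, arcSum L (fun s => w s - u) i = arcSum L w i - L * u := fun i => by
    rw [← arcSum_const L u i, arcSum, arcSum, arcSum, ← Finset.sum_sub_distrib]
    exact Finset.sum_congr rfl fun s _ => by split_ifs <;> simp
  have e3 : ∑ i, arcSum L (fun s => w s - u) i ^ 2 = ∑ i, arcSum L w i ^ 2 - L ^ 2 * u := by
    simp only [e2, sub_sq, Finset.sum_add_distrib, Finset.sum_sub_distrib, ← Finset.sum_mul,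
      ← Finset.mul_sum, sum_arcSum, hw]
    simp only [Finset.sum_const, Finset.card_univ, ZMod.card, nsmul_eq_mul]
    push_cast
    linear_combination L ^ 2 * u * hnu
  rw [e1, e3, sum_arcSum_sq, hw] at h
  have e4 : (L * (L + 1) / (2 * L + 1) : ℝ) = L - L ^ 2 * u := by
    rw [hu]; field_simp; ring
  rw [e4]
  calc _ = _ := by ring
    _ ≤ _ := h

/-! ### Irrationality of `π²` -/

/-- Cartwright's integrals `∫ (1 - x²)ⁿ cos (π x / 2)` over `[-1, 1]`. -/
noncomputable def cartwrightIntegral (n : ℕ) : ℝ :=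
  ∫ x in (-1 : ℝ)..1, (1 - x ^ 2) ^ n * Real.cos (x * (Real.pi / 2))

theorem cartwrightIntegral_zero : cartwrightIntegral 0 * (Real.pi / 2) = 2 := by
  rw [cartwrightIntegral]
  simp [mul_comm]
  field_simp
  norm_num

theorem cartwrightIntegral_one :
    cartwrightIntegral 1 * (Real.pi / 2) ^ 2 = 2 * cartwrightIntegral 0 := by
  set t := Real.pi / 2 with ht
  have hd : ∀ x ∈ Set.uIcc (-1 : ℝ) 1, HasDerivAt
      (fun x => t * (1 - x ^ 2) * Real.sin (x * t) - 2 * x * Real.cos (x * t))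
      (t ^ 2 * ((1 - x ^ 2) ^ 1 * Real.cos (x * t)) -
        2 * ((1 - x ^ 2) ^ 0 * Real.cos (x * t))) x := by
    intro x _
    have hf : HasDerivAt (fun x : ℝ => 1 - x ^ 2) (-(2 * x)) x := by
      simpa using (hasDerivAt_pow 2 x).const_sub 1
    have hs := (hasDerivAt_mul_const (x := x) t).sin
    have hc := (hasDerivAt_mul_const (x := x) t).cos
    refine (((hf.const_mul t).mul hs).sub (((hasDerivAt_id' x).const_mul 2).mul hc)).congr_deriv ?_
    ring
  have h := intervalIntegral.integral_eq_sub_of_hasDerivAt hd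
    (Continuous.intervalIntegrable (by fun_prop) _ _)
  rw [intervalIntegral.integral_sub (Continuous.intervalIntegrable (by fun_prop) _ _)
    (Continuous.intervalIntegrable (by fun_prop) _ _), intervalIntegral.integral_const_mul,
    intervalIntegral.integral_const_mul] at h
  have hc : Real.cos t = 0 := Real.cos_pi_div_two
  simp only [neg_mul, one_mul, Real.cos_neg, hc] at h
  norm_num at h
  simp only [cartwrightIntegral, ← ht]
  norm_num
  linarith

/-- The recursion comes from two integrations by parts, written here as one explicit
antiderivative that vanishes at `±1`. -/
theorem cartwrightIntegral_add_two (n : ℕ) :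
    cartwrightIntegral (n + 2) * (Real.pi / 2) ^ 2 =
      2 * (n + 2) * (2 * n + 3) * cartwrightIntegral (n + 1) -
        4 * (n + 2) * (n + 1) * cartwrightIntegral n := by
  set t := Real.pi / 2 with ht
  have hd : ∀ x ∈ Set.uIcc (-1 : ℝ) 1, HasDerivAt
      (fun x => t * (1 - x ^ 2) ^ (n + 2) * Real.sin (x * t) -
        2 * (n + 2) * x * (1 - x ^ 2) ^ (n + 1) * Real.cos (x * t))
      (t ^ 2 * ((1 - x ^ 2) ^ (n + 2) * Real.cos (x * t)) -
        2 * (n + 2) * (2 * n + 3) * ((1 - x ^ 2) ^ (n + 1) * Real.cos (x * t)) +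
        4 * (n + 2) * (n + 1) * ((1 - x ^ 2) ^ n * Real.cos (x * t))) x := by
    intro x _
    have hf : HasDerivAt (fun x : ℝ => 1 - x ^ 2) (-(2 * x)) x := by
      simpa using (hasDerivAt_pow 2 x).const_sub 1
    have hs := (hasDerivAt_mul_const (x := x) t).sin
    have hc := (hasDerivAt_mul_const (x := x) t).cos
    have h1 := ((hf.fun_pow (n + 2)).const_mul t).mul hs
    have h2 := ((((hasDerivAt_id' x).const_mul (2 * ((n : ℝ) + 2))).mul
      (hf.fun_pow (n + 1))).mul hc)
    refine (h1.sub h2).congr_deriv ?_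
    simp only [Pi.mul_apply, Nat.add_sub_cancel, show n + 2 - 1 = n + 1 from rfl]
    push_cast
    ring
  have h := intervalIntegral.integral_eq_sub_of_hasDerivAt hd
    (Continuous.intervalIntegrable (by fun_prop) _ _)
  rw [intervalIntegral.integral_add (Continuous.intervalIntegrable (by fun_prop) _ _)
    (Continuous.intervalIntegrable (by fun_prop) _ _),
    intervalIntegral.integral_sub (Continuous.intervalIntegrable (by fun_prop) _ _)
    (Continuous.intervalIntegrable (by fun_prop) _ _), intervalIntegral.integral_const_mul,
    intervalIntegral.integral_const_mul, intervalIntegral.integral_const_mul] at h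
  simp only [cartwrightIntegral, ← ht]
  have hz : (t * (1 - (1 : ℝ) ^ 2) ^ (n + 2) * Real.sin (1 * t) -
        2 * (n + 2) * 1 * (1 - (1 : ℝ) ^ 2) ^ (n + 1) * Real.cos (1 * t)) -
      (t * (1 - (-1 : ℝ) ^ 2) ^ (n + 2) * Real.sin (-1 * t) -
        2 * (n + 2) * (-1) * (1 - (-1 : ℝ) ^ 2) ^ (n + 1) * Real.cos (-1 * t)) = 0 := by
    simp
  linarith

theorem cartwrightIntegral_pos (n : ℕ) : 0 < cartwrightIntegral n := by
  refine intervalIntegral.integral_pos (by simp) (by fun_prop) ?_ ⟨0, by simp⟩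
  refine fun x hx => mul_nonneg (pow_nonneg (by nlinarith [hx.1, hx.2]) _) ?_
  refine Real.cos_nonneg_of_neg_pi_div_two_le_of_le ?_ ?_ <;>
  nlinarith [hx.1, hx.2, Real.pi_pos]

theorem cartwrightIntegral_le (n : ℕ) : cartwrightIntegral n ≤ 2 := by
  rw [← Real.norm_of_nonneg (cartwrightIntegral_pos n).le]
  refine (intervalIntegral.norm_integral_le_of_norm_le_const (C := 1) ?_).trans (by norm_num)
  intro x hx
  rw [Set.uIoc_of_le (by norm_num)] at hx
  rw [Real.norm_eq_abs, abs_mul, abs_pow]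
  refine mul_le_one₀ (pow_le_one₀ (abs_nonneg _) ?_) (abs_nonneg _) (Real.abs_cos_le_one _)
  rw [abs_le]
  constructor <;> nlinarith [hx.1, hx.2]

/-- If `(π / 2)² = a / b`, the recursion makes `bⁿ (π / 2)²ⁿ⁺¹ / n!` times the `n`-th integral an
integer. Only even powers of `π / 2` enter the recursion, which is why irrationality of `π²`, and
not merely of `π`, follows. -/
theorem exists_int_cartwrightIntegral {a b : ℤ} (hb : b ≠ 0)
    (hab : (Real.pi / 2) ^ 2 = a / b) (n : ℕ) :
    (∃ z : ℤ, (b : ℝ) ^ n * (cartwrightIntegral n * (Real.pi / 2) ^ (2 * n + 1)) =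
      n.factorial * z) ∧
    (∃ z : ℤ, (b : ℝ) ^ (n + 1) * (cartwrightIntegral (n + 1) *
      (Real.pi / 2) ^ (2 * (n + 1) + 1)) = (n + 1).factorial * z) := by
  have hb' : (b : ℝ) ≠ 0 := by exact_mod_cast hb
  have hab' : (b : ℝ) * (Real.pi / 2) ^ 2 = a := by rw [hab]; field_simp
  have h0 := cartwrightIntegral_zero
  set t := Real.pi / 2
  induction n with
  | zero =>
    have h1 : cartwrightIntegral 1 * t ^ 2 = 2 * cartwrightIntegral 0 := cartwrightIntegral_one
    refine ⟨⟨2, by simp [h0]⟩, ⟨4 * b, ?_⟩⟩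
    simp only [zero_add, pow_one, Nat.factorial_one]
    push_cast
    linear_combination (b : ℝ) * t * h1 + 2 * b * h0
  | succ n ih =>
    obtain ⟨⟨x, hx⟩, ⟨y, hy⟩⟩ := ih
    refine ⟨⟨y, hy⟩, ⟨2 * (2 * n + 3) * b * y - 4 * a * b * x, ?_⟩⟩
    have h2 : cartwrightIntegral (n + 2) * t ^ 2 = _ := cartwrightIntegral_add_two n
    rw [Nat.factorial_succ] at hy ⊢
    rw [Nat.factorial_succ]
    push_cast at hy ⊢
    rw [show n + 1 + 1 = n + 2 from rfl]
    linear_combination (b : ℝ) ^ (n + 2) * t ^ (2 * n + 3) * h2 +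
      2 * (n + 2) * (2 * n + 3) * b * hy - 4 * (n + 2) * (n + 1) * b ^ 2 * t ^ 2 * hx -
      4 * (n + 2) * (n + 1) * b * n.factorial * x * hab'

/-- The integers of `exists_int_cartwrightIntegral` would be positive and tend to zero. -/
theorem irrational_pi_sq : Irrational (Real.pi ^ 2) := by
  rintro ⟨q, hq⟩
  have hb0 : ((4 * q.den : ℤ)) ≠ 0 := by have := q.den_nz; positivity
  have hab : (Real.pi / 2) ^ 2 = (q.num : ℝ) / ((4 * q.den : ℤ) : ℝ) := by
    have h : (q : ℝ) = q.num / q.den := by exact_mod_cast (Rat.num_div_den q).symm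
    push_cast
    rw [div_pow, ← hq, h]
    have : (q.den : ℝ) ≠ 0 := by exact_mod_cast q.den_nz
    field_simp
    norm_num
  have hbpos : (0 : ℝ) < ((4 * q.den : ℤ) : ℝ) := by
    have := q.den_pos; push_cast; positivity
  generalize (4 * q.den : ℤ) = b at hb0 hab hbpos
  have ht : 0 < Real.pi / 2 := Real.pi_div_two_pos
  have hlim := ((FloorSemiring.tendsto_pow_div_factorial_atTop
    ((b : ℝ) * (Real.pi / 2) ^ 2)).const_mul (2 * (Real.pi / 2)))
  rw [mul_zero] at hlim
  -- choose `n` with `2 (π / 2) (b (π / 2)²)ⁿ / n! < 1`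
  obtain ⟨n, hn⟩ := (hlim.eventually_lt_const zero_lt_one).exists
  obtain ⟨z, hz⟩ := (exists_int_cartwrightIntegral hb0 hab n).1
  have hfac : (0 : ℝ) < n.factorial := by exact_mod_cast n.factorial_pos
  have hI := cartwrightIntegral_pos n
  have hI2 := cartwrightIntegral_le n
  have hz0 : (0 : ℝ) < z := by
    have : (0 : ℝ) < n.factorial * z := by rw [← hz]; positivity
    exact pos_of_mul_pos_right this hfac.le
  have hz1 : (z : ℝ) < 1 := by
    rw [← mul_div_assoc, div_lt_one hfac] at hn
    have h1 : (n.factorial : ℝ) * z ≤ 2 * (Real.pi / 2) * ((b : ℝ) * (Real.pi / 2) ^ 2) ^ n := by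
      rw [← hz]
      calc (b : ℝ) ^ n * (cartwrightIntegral n * (Real.pi / 2) ^ (2 * n + 1))
          ≤ (b : ℝ) ^ n * (2 * (Real.pi / 2) ^ (2 * n + 1)) := by gcongr
        _ = _ := by rw [mul_pow, ← pow_mul]; ring
    exact lt_of_mul_lt_mul_left (by linarith) hfac.le
  norm_cast at hz0 hz1
  lia

/-! ### The limit of the threshold -/

theorem floor_eventuallyEq_of_irrational {f : ℕ → ℝ} {c : ℝ} (hc : Irrational c)
    (hf : Tendsto f atTop (𝓝 c)) : ∀ᶠ n in atTop, ⌊f n⌋ = ⌊c⌋ := by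
  have h1 : (⌊c⌋ : ℝ) < c := lt_of_le_of_ne (Int.floor_le c) (hc.ne_int _).symm
  filter_upwards [hf.eventually_const_lt h1, hf.eventually_lt_const (Int.lt_floor_add_one c)]
    with n h2 h3
  exact Int.floor_eq_iff.2 ⟨h2.le, h3⟩

/-- With `x = π / (2 (2N-1))` the threshold is `sinc² x` times a rational function of `1 / N`. -/
theorem tendsto_setSizeThreshold (M : ℕ) {Zy : ℕ} (hZ : 1 ≤ Zy) :
    Tendsto (fun N : ℕ => setSizeThreshold M N Zy) atTop
      (𝓝 (Real.pi ^ 2 * (M : ℝ) / (4 * (Zy : ℝ)))) := by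
  have hZ' : (0 : ℝ) < Zy := by exact_mod_cast hZ
  have hinv : Tendsto (fun N : ℕ => 1 / (N : ℝ)) atTop (𝓝 0) := tendsto_one_div_atTop_nhds_zero_nat
  -- for `N ≥ 1` this is `π / (2 (2N-1))`, written in terms of `1 / N`
  have hx : Tendsto (fun N : ℕ => Real.pi / 2 * (1 / (N : ℝ)) / (2 - 1 / (N : ℝ))) atTop (𝓝 0) := by
    have h := (hinv.const_mul (Real.pi / 2)).div (hinv.const_sub 2) (by norm_num)
    rw [mul_zero, zero_div] at h
    exact h
  have hsinc := (Real.continuous_sinc.tendsto 0).comp hx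
  rw [Real.sinc_zero] at hsinc
  have hrat : Tendsto (fun N : ℕ => Real.pi ^ 2 / Zy * (M - Zy * (1 / (N : ℝ))) /
      (2 - 1 / (N : ℝ)) ^ 2) atTop (𝓝 (Real.pi ^ 2 / Zy * (M - Zy * 0) / (2 - 0) ^ 2)) :=
    (((hinv.const_mul (Zy : ℝ)).const_sub (M : ℝ)).const_mul (Real.pi ^ 2 / Zy)).div
      ((hinv.const_sub 2).pow 2) (by norm_num)
  have h := hrat.mul (hsinc.pow 2)
  have hlim : Real.pi ^ 2 / Zy * (M - Zy * 0) / (2 - 0) ^ 2 * 1 ^ 2 =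
      Real.pi ^ 2 * (M : ℝ) / (4 * (Zy : ℝ)) := by
    field_simp
    ring
  rw [hlim] at h
  refine h.congr' ?_
  filter_upwards [eventually_ge_atTop 1] with N hN
  have hN' : (1 : ℝ) ≤ N := by exact_mod_cast hN
  have h2 : (2 * (N : ℝ) - 1) ≠ 0 := by linarith
  have hden : 2 - 1 / (N : ℝ) = (2 * N - 1) / N := by field_simp
  have harg : Real.pi / 2 * (1 / (N : ℝ)) / (2 - 1 / (N : ℝ)) =
      Real.pi / (2 * (2 * (N : ℝ) - 1)) := by
    rw [hden]; field_simp
  have hne : Real.pi / (2 * (2 * (N : ℝ) - 1)) ≠ 0 :=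
    div_ne_zero Real.pi_ne_zero (mul_ne_zero two_ne_zero h2)
  simp only [Function.comp_apply, harg, setSizeThreshold]
  rw [Real.sinc_of_ne_zero hne, hden]
  have hpi := Real.pi_ne_zero
  generalize 2 * (N : ℝ) - 1 = n at h2
  field_simp
  ring

theorem irrational_pi_sq_mul_div {M Zy : ℕ} (hM : 1 ≤ M) (hZ : 1 ≤ Zy) :
    Irrational (Real.pi ^ 2 * (M : ℝ) / (4 * (Zy : ℝ))) := by
  have h := (irrational_pi_sq.mul_natCast (m := M) (by lia)).div_natCast (m := 4 * Zy) (by lia)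
  exact_mod_cast h

/-! ### Optimality of the uniform weight vector -/

theorem quadForm_eq {N : ℕ} (hN : 1 ≤ N) (w : Fin (2 * N - 1) → ℝ) (a : ℝ) :
    quadForm N w a = a * ∑ s, w s ^ 2 + ∑ s, ∑ t, cyclicDist N s t * (w s * w t) := by
  have hN' : (1 : ℝ) ≤ N := by exact_mod_cast hN
  simp only [quadForm, quadMatrix, dotProduct, Matrix.mulVec, Matrix.of_apply]
  rw [Finset.mul_sum, ← Finset.sum_add_distrib]
  refine Finset.sum_congr rfl fun s _ => ?_
  have h : ∀ t, (if s = t then a else cyclicDist N s t) * w t =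
      (if s = t then a * w t else 0) + cyclicDist N s t * w t := by
    intro t
    split_ifs with hst
    · have : cyclicDist N s t = 0 := by
        subst hst
        simp only [cyclicDist, sub_self, abs_zero]
        exact min_eq_left (by linarith)
      rw [this]; ring
    · ring
  simp only [h, Finset.sum_add_distrib, Finset.sum_ite_eq, Finset.mem_univ, if_true, mul_add,
    Finset.mul_sum]
  congr 1
  · ring
  · exact Finset.sum_congr rfl fun t _ => by ring

theorem le_sum_cyclicDist {N : ℕ} (hN : 1 ≤ N) (w : Fin (2 * N - 1) → ℝ) (hw : ∑ s, w s = 1) :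
    4 * Real.sin (Real.pi / (2 * (2 * (N : ℝ) - 1))) ^ 2 *
      ((N - 1) * N / (2 * N - 1) - ∑ s, ∑ t, cyclicDist N s t * (w s * w t)) ≤
      ∑ s, w s ^ 2 - 1 / (2 * N - 1) := by
  obtain ⟨L, rfl⟩ : ∃ L, N = L + 1 := ⟨N - 1, by lia⟩
  have e : 2 * ((L + 1 : ℕ) : ℝ) - 1 = 2 * L + 1 := by push_cast; ring
  have e' : ((L + 1 : ℕ) : ℝ) - 1 = L := by push_cast; ring
  simp only [cyclicDist, e, e']
  push_cast
  exact le_sum_cyclic L w hw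

theorem sum_cyclicDist_uniformWeight {N : ℕ} (hN : 1 ≤ N) :
    ∑ s, ∑ t, cyclicDist N s t * (uniformWeight N s * uniformWeight N t) =
      (N - 1) * N / (2 * N - 1) := by
  obtain ⟨L, rfl⟩ : ∃ L, N = L + 1 := ⟨N - 1, by lia⟩
  have e : 2 * ((L + 1 : ℕ) : ℝ) - 1 = 2 * L + 1 := by push_cast; ring
  have e' : ((L + 1 : ℕ) : ℝ) - 1 = L := by push_cast; ring
  simp only [cyclicDist, uniformWeight, e, e']
  refine (sum_cyclic_const L (1 / (2 * L + 1))).trans ?_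
  push_cast
  field_simp

theorem natCast_two_mul_sub_one {N : ℕ} (hN : 1 ≤ N) : ((2 * N - 1 : ℕ) : ℝ) = 2 * N - 1 := by
  rw [Nat.cast_sub (by lia)]; push_cast; ring

theorem uniformWeight_mem {N : ℕ} (hN : 1 ≤ N) : uniformWeight N ∈ weightVectors N := by
  have hN' : (1 : ℝ) ≤ N := by exact_mod_cast hN
  have hn : (0 : ℝ) < 2 * N - 1 := by linarith
  refine ⟨fun r => by unfold uniformWeight; positivity, ?_⟩
  simp only [uniformWeight, Finset.sum_const, Finset.card_univ, Fintype.card_fin, nsmul_eq_mul,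
    natCast_two_mul_sub_one hN]
  field_simp

theorem sum_sq_uniformWeight {N : ℕ} (hN : 1 ≤ N) :
    ∑ r, uniformWeight N r ^ 2 = 1 / (2 * N - 1) := by
  have hN' : (1 : ℝ) ≤ N := by exact_mod_cast hN
  have hn : (0 : ℝ) < 2 * N - 1 := by linarith
  simp only [uniformWeight, Finset.sum_const, Finset.card_univ, Fintype.card_fin, nsmul_eq_mul,
    natCast_two_mul_sub_one hN]
  field_simp

theorem one_div_le_sum_sq {N : ℕ} (hN : 1 ≤ N) {w : Fin (2 * N - 1) → ℝ}
    (hw : w ∈ weightVectors N) : 1 / (2 * (N : ℝ) - 1) ≤ ∑ r, w r ^ 2 := by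
  have hN' : (1 : ℝ) ≤ N := by exact_mod_cast hN
  have h := sq_sum_le_card_mul_sum_sq (s := Finset.univ) (f := w)
  rw [hw.2, Finset.card_univ, Fintype.card_fin, natCast_two_mul_sub_one hN] at h
  rw [div_le_iff₀' (by linarith)]
  linarith

theorem sum_sq_le_one {N : ℕ} {w : Fin (2 * N - 1) → ℝ}
    (hw : w ∈ weightVectors N) : ∑ r, w r ^ 2 ≤ 1 := by
  rw [← hw.2]
  refine Finset.sum_le_sum fun r _ => ?_
  have h1 : w r ≤ 1 := hw.2 ▸ Finset.single_le_sum (fun i _ => hw.1 i) (Finset.mem_univ r)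
  nlinarith [hw.1 r]

/-- The denominator is nonnegative because `∑ r, w r ^ 2 ≤ 1 ≤ K`. -/
theorem boundDenom_pos {K N : ℕ} (hK : 1 ≤ K) {w : Fin (2 * N - 1) → ℝ}
    (hw : w ∈ weightVectors N) (h : boundDenom K N w ≠ 0) : 0 < boundDenom K N w := by
  refine lt_of_le_of_ne ?_ h.symm
  have hK' : (1 : ℝ) ≤ K := by exact_mod_cast hK
  have h1 : 1 / (K : ℝ) ≤ 1 := by rw [div_le_one (by linarith)]; exact hK'
  have h2 : 1 / (K : ℝ) * ∑ r, w r ^ 2 ≤ 1 * 1 :=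
    mul_le_mul h1 (sum_sq_le_one hw) (Finset.sum_nonneg fun _ _ => sq_nonneg _) zero_le_one
  rw [boundDenom]
  linarith

/-- If the diagonal entry is at least `1 / (4 sin² (π / (2 (2N-1))))`, it outweighs the most negative
eigenvalue of the cyclic distance on vectors of total mass zero, and the uniform weight vector
minimizes the quadratic form. -/
theorem quadForm_uniformWeight_le {N : ℕ} (hN : 1 ≤ N) {a : ℝ}
    (ha : 1 ≤ a * (4 * Real.sin (Real.pi / (2 * (2 * (N : ℝ) - 1))) ^ 2))
    {w : Fin (2 * N - 1) → ℝ} (hw : w ∈ weightVectors N) :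
    quadForm N (uniformWeight N) a ≤ quadForm N w a := by
  rw [quadForm_eq hN, quadForm_eq hN, sum_sq_uniformWeight hN, sum_cyclicDist_uniformWeight hN]
  have h := le_sum_cyclicDist hN w hw.2
  have hW := one_div_le_sum_sq hN hw
  set μ := 4 * Real.sin (Real.pi / (2 * (2 * (N : ℝ) - 1))) ^ 2
  set T := ∑ s, ∑ t, cyclicDist N s t * (w s * w t)
  set W := ∑ r, w r ^ 2
  have hμ0 : 0 ≤ μ := by positivity
  have hμ : 0 < μ := hμ0.lt_of_ne fun h0 => by rw [← h0] at ha; linarith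
  have h2 : W - 1 / (2 * N - 1) ≤ a * μ * (W - 1 / (2 * N - 1)) :=
    le_mul_of_one_le_left (by linarith) ha
  have h3 : (N - 1) * N / (2 * N - 1) - T ≤ a * (W - 1 / (2 * N - 1)) := by
    refine le_of_mul_le_mul_left ?_ hμ
    linarith
  linarith

theorem one_lt_mul_card {K N : ℕ} (hK : 1 ≤ K) (hN : 1 ≤ N)
    (hKN : ¬ (K = 1 ∧ N = 1)) : (1 : ℝ) < K * (2 * N - 1) := by
  have hN' : (1 : ℝ) ≤ N := by exact_mod_cast hN
  have hK' : (1 : ℝ) ≤ K := by exact_mod_cast hK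
  rcases hK.eq_or_lt with rfl | h
  · have : (1 : ℝ) < N := by exact_mod_cast (by lia : 1 < N)
    push_cast; linarith
  · have : (1 : ℝ) < K := by exact_mod_cast h
    nlinarith

theorem boundDenom_uniformWeight_ne_zero {K N : ℕ} (hK : 1 ≤ K) (hN : 1 ≤ N)
    (hKN : ¬ (K = 1 ∧ N = 1)) : boundDenom K N (uniformWeight N) ≠ 0 := by
  have h := one_lt_mul_card hK hN hKN
  rw [boundDenom, sum_sq_uniformWeight hN, one_div_mul_one_div]
  have := (div_lt_one (zero_lt_one.trans h)).2 h
  linarith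

theorem weightedBound_uniformWeight {K M N Zy : ℕ} (hK : 1 ≤ K) (hM : 1 ≤ M) (hN : 1 ≤ N)
    (hZ : 1 ≤ Zy) (hKN : ¬ (K = 1 ∧ N = 1)) :
    weightedBound K M N Zy (uniformWeight N) = uniformBound K M N Zy := by
  have hN' : (1 : ℝ) ≤ N := by exact_mod_cast hN
  have hK' : (0 : ℝ) < K := by exact_mod_cast hK
  have hM' : (0 : ℝ) < M := by exact_mod_cast hM
  have hZ' : (0 : ℝ) < Zy := by exact_mod_cast hZ
  have hn : (2 * N - 1 : ℝ) ≠ 0 := by linarith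
  have hKn : (K * (2 * N - 1) - 1 : ℝ) ≠ 0 := by linarith [one_lt_mul_card hK hN hKN]
  rw [weightedBound, uniformBound, quadForm_eq hN, boundDenom, sum_sq_uniformWeight hN,
    sum_cyclicDist_uniformWeight hN]
  have hd : 1 - 1 / (K : ℝ) * (1 / (2 * N - 1)) = (K * (2 * N - 1) - 1) / (K * (2 * N - 1)) := by
    field_simp
  rw [hd]
  have hNn : (N : ℝ) - 1 = (2 * N - 1) - N := by ring
  rw [hNn]
  generalize hn_def : 2 * (N : ℝ) - 1 = n at hn hKn
  field_simp
  rw [← hn_def]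
  ring

/-- The uniform weight vector minimizes the (nonnegative) quadratic form and maximizes the
(positive) denominator, hence maximizes the bound. -/
theorem cannotBeImproved_of_le {K M N Zy : ℕ} (hK : 1 ≤ K) (hM : 1 ≤ M) (hZ : 1 ≤ Zy)
    (hZN : Zy ≤ N) (hKN : ¬ (K = 1 ∧ N = 1)) (h : (K : ℤ) ≤ ⌊setSizeThreshold M N Zy⌋) :
    CannotBeImproved K M N Zy := by
  have hN : 1 ≤ N := hZ.trans hZN
  have hN' : (1 : ℝ) ≤ N := by exact_mod_cast hN
  have hK' : (0 : ℝ) < K := by exact_mod_cast hK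
  have hZ' : (0 : ℝ) < Zy := by exact_mod_cast hZ
  have hne := boundDenom_uniformWeight_ne_zero hK hN hKN
  have hmem := uniformWeight_mem hN
  have hval := weightedBound_uniformWeight hK hM hN hZ hKN
  refine ⟨hmem, hne, hval, ⟨uniformWeight N, hmem, hne, hval.symm⟩, ?_⟩
  rintro b ⟨w, hw, hwne, rfl⟩
  rw [← hval, weightedBound, weightedBound]
  set a : ℝ := (N : ℝ) * ((M : ℝ) * (N : ℝ) - (Zy : ℝ)) / ((K : ℝ) * (Zy : ℝ)) with ha_def
  have ha : 1 ≤ a * (4 * Real.sin (Real.pi / (2 * (2 * (N : ℝ) - 1))) ^ 2) := by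
    have hK2 : (K : ℝ) ≤ setSizeThreshold M N Zy := by
      exact_mod_cast Int.le_floor.1 h
    -- the hypothesis on `K` says exactly that the diagonal entry `a` is large enough
    have : a * (4 * Real.sin (Real.pi / (2 * (2 * (N : ℝ) - 1))) ^ 2) =
        setSizeThreshold M N Zy / K := by
      rw [ha_def, setSizeThreshold]; field_simp
    rw [this]
    exact (one_le_div hK').2 hK2
  have hQ := quadForm_uniformWeight_le hN ha hw
  have hQ0 : 0 ≤ quadForm N (uniformWeight N) a := by
    rw [quadForm_eq hN, sum_sq_uniformWeight hN, sum_cyclicDist_uniformWeight hN]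
    have ha0 : 0 < a := pos_of_mul_pos_left (zero_lt_one.trans_le ha) (by positivity)
    have h1 : (0 : ℝ) ≤ N - 1 := by linarith
    have h2 : (0 : ℝ) < 2 * N - 1 := by linarith
    positivity
  have hd : boundDenom K N w ≤ boundDenom K N (uniformWeight N) := by
    rw [boundDenom, boundDenom, sum_sq_uniformWeight hN]
    have := one_div_le_sum_sq hN hw
    gcongr
  have hdiv := div_le_div₀ (hQ0.trans hQ) hQ (boundDenom_pos hK hw hwne) hd
  gcongr

theorem mainTheorem7 :
    (∀ K M N Zy : ℕ, 1 ≤ K → 1 ≤ M → 1 ≤ Zy → Zy ≤ N → ¬ (K = 1 ∧ N = 1) →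
      (K : ℤ) ≤ ⌊setSizeThreshold M N Zy⌋ → CannotBeImproved K M N Zy) ∧
    (∀ M Zy : ℕ, 1 ≤ M → 1 ≤ Zy →
      Tendsto (fun N : ℕ => setSizeThreshold M N Zy) atTop
        (𝓝 (Real.pi ^ 2 * (M : ℝ) / (4 * (Zy : ℝ)))) ∧
      (∀ᶠ N : ℕ in atTop,
        ⌊setSizeThreshold M N Zy⌋ = ⌊Real.pi ^ 2 * (M : ℝ) / (4 * (Zy : ℝ))⌋) ∧
      (∀ᶠ N : ℕ in atTop, ∀ K : ℕ, 1 ≤ K →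
        (K : ℤ) ≤ ⌊Real.pi ^ 2 * (M : ℝ) / (4 * (Zy : ℝ))⌋ → CannotBeImproved K M N Zy)) := by
  refine ⟨fun K M N Zy hK hM hZ hZN hKN h => cannotBeImproved_of_le hK hM hZ hZN hKN h,
    fun M Zy hM hZ => ?_⟩
  have hlim := tendsto_setSizeThreshold M hZ
  have hfloor := floor_eventuallyEq_of_irrational (irrational_pi_sq_mul_div hM hZ) hlim
  refine ⟨hlim, hfloor, ?_⟩
  filter_upwards [hfloor, eventually_ge_atTop Zy, eventually_ge_atTop 2] with N hN hZN hN2 K hK h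
  exact cannotBeImproved_of_le hK hM hZ hZN (by lia) (hN ▸ h)
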